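/- Let $0<p<2$. Let $X, X_1, X_2, \dots$ be identically distributed real-valued random variables on a probability space $(\Omega,\mathcal F,\mathbb P)$ with $X_1, X_2, \dots$ independent, and put $S_n = X_1+\dots+X_n$. Define, with $\log 0=-\infty$, $$\bar\beta = -\limsup_{t\to\infty}\frac1t\log\mathbb P(\log|X|>t)\in[0,\infty],\qquad \underline\beta = -\liminf_{t\to\infty}\frac1t\log\mathbb P(\log|X|>t)\in[0,\infty].$$ Suppose that * if $0<p<1$: $\displaystyle\lim_{n\to\infty} n\,\mathbb P(|X|>n^{1/p})=0$; * if $p=1$: $\displaystyle\lim_{n\to\infty}\bigl(\,\bigl|\mathbb E[X\,I(|X|\le n)]\bigr| + n\,\mathbb P(|X|>n)\bigr)=0$; * if $1<p<2$: $\mathbb E X=0$ (with $X$ integrable) and $\displaystyle\lim_{n\to\infty} n\,\mathbb P(|X|>n^{1/p})=0$. Then, for every $s>0$, $$\limsup_{n\to\infty}\frac1{\log n}\log\mathbb P\bigl(|S_n|>s\,n^{1/p}\bigr) = -(\bar\beta-p)/p,\qquad \liminf_{n\to\infty}\frac1{\log n}\log\mathbb P\bigl(|S_n|>s\,n^{1/p}\bigr)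 = -(\underline\beta-p)/p,$$ where $(\pm\infty-p)/p=\pm\infty$. Moreover, for every $s>0$ and every $\hat\beta\in[-\infty,\infty]$, $$\lim_{n\to\infty}\frac1{\log n}\log\mathbb P\bigl(|S_n|>s\,n^{1/p}\bigr) = -(\hat\beta-p)/p \quad\text{if and only if}\quad \bar\beta=\underline\beta=\hat\beta.$$ -/

import Mathlib

open MeasureTheory ProbabilityTheory Filter Topology

/-- `(1 / t) * log P(log |X| > t)` as an extended real (`ENNReal.log 0 = ⊥`). Only large `t` matter
below; for `t ≥ 0` the convention `Real.log 0 = 0` gives the same event as `log 0 = -∞`. -/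
noncomputable def logTailRate {Ω : Type*} [MeasurableSpace Ω] (P : Measure Ω) (X : Ω → ℝ)
    (t : ℝ) : EReal :=
  ((1 / t : ℝ) : EReal) * ENNReal.log (P {ω | t < Real.log |X ω|})

/-- `β̄ = - limsup_{t → ∞} (1 / t) log P(log |X| > t)`. -/
noncomputable def betaUpper {Ω : Type*} [MeasurableSpace Ω] (P : Measure Ω) (X : Ω → ℝ) : EReal :=
  -limsup (fun t : ℝ => logTailRate P X t) atTop

/-- `β_ = - liminf_{t → ∞} (1 / t) log P(log |X| > t)`. -/
noncomputable def betaLower {Ω : Type*} [MeasurableSpace Ω] (P : Measure Ω) (X : Ω → ℝ) : EReal :=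
  -liminf (fun t : ℝ => logTailRate P X t) atTop

/-- The Kolmogorov-Feller weak law conditions with exponent `p`. -/
def WeakLawCondition {Ω : Type*} [MeasurableSpace Ω] (P : Measure Ω) (X : Ω → ℝ) (p : ℝ) : Prop :=
  (p < 1 →
    Tendsto (fun n : ℕ => (n : ℝ) * P.real {ω | (n : ℝ) ^ (1 / p) < |X ω|}) atTop (𝓝 0)) ∧
  (p = 1 →
    Tendsto (fun n : ℕ => |∫ ω in {ω | |X ω| ≤ (n : ℝ)}, X ω ∂P| +
      (n : ℝ) * P.real {ω | (n : ℝ) < |X ω|}) atTop (𝓝 0)) ∧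
  (1 < p →
    (Integrable X P ∧ ∫ ω, X ω ∂P = 0) ∧
    Tendsto (fun n : ℕ => (n : ℝ) * P.real {ω | (n : ℝ) ^ (1 / p) < |X ω|}) atTop (𝓝 0))

/-- The partial sum of the first `n` terms of the sequence, which is numbered from `0`. -/
def partialSum {Ω : Type*} (Xs : ℕ → Ω → ℝ) (n : ℕ) (ω : Ω) : ℝ :=
  ∑ i ∈ Finset.range n, Xs i ω

/-- `(1 / log n) * log P(|S_n| > s n^{1/p})` as an extended real. -/
noncomputable def logDeviationRate {Ω : Type*} [MeasurableSpace Ω] (P : Measure Ω)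
    (Xs : ℕ → Ω → ℝ) (p s : ℝ) (n : ℕ) : EReal :=
  ((1 / Real.log n : ℝ) : EReal) *
    ENNReal.log (P {ω | s * (n : ℝ) ^ (1 / p) < |partialSum Xs n ω|})

/-! A large value of `S_n` is essentially due to one large summand, so on the scale of powers of `n`
the probability of `|S_n| > s n^{1/p}` is that of `n P(|X| > n^{1/p})`. With `t = (log n) / p`, its
logarithm divided by `log n` is `1 + (1/p)` times the tail rate at `t`, whence `-(β - p) / p`.

Upper bound (`WeakLawCondition.exists_upper_bound`): truncate slightly too low, at `n^{k/p}` with `k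
< 1`. A union bound pays `n P(|X| > n^{k/p})`, and the Chernoff bound for the truncated sum then has
room for a stretched exponential error, negligible against any power of `n`. Finally `k` is taken
close to 1.

Lower bound (`WeakLawCondition.exists_lower_bound`): one summand exceeds `A n^{1/p}` while the
others stay smaller and have a sum of order `n^{1/p}`. These events are disjoint over the index of
the large summand, and the second requirement has probability at least `1/2`.

The weak law conditions supply tails `O(t^{-p})`, hence truncated second moments, and control of the
truncated means. The rates are defined along real `t`; monotonicity of the tail transfers them to
the sequences `α log n + d`. -/

/-- The truncation of `x` at level `b`. -/
noncomputable def trunc (b x : ℝ) : ℝ := if |x| ≤ b then x else 0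

lemma measurable_trunc (b : ℝ) : Measurable (trunc b) :=
  Measurable.ite (measurableSet_le measurable_abs measurable_const) measurable_id measurable_const

lemma abs_trunc_le {b : ℝ} (hb : 0 ≤ b) (x : ℝ) : |trunc b x| ≤ b := by
  unfold trunc; split_ifs with h
  · exact h
  · simpa using hb

lemma abs_trunc_le_abs (b x : ℝ) : |trunc b x| ≤ |x| := by
  unfold trunc; split_ifs <;> simp

lemma identDistrib_measureReal_lt_abs {Ω : Type*} [MeasurableSpace Ω] {P : Measure Ω}
    {X Y : Ω → ℝ} (h : IdentDistrib X Y P P) (t : ℝ) :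
    P.real {ω | t < |X ω|} = P.real {ω | t < |Y ω|} :=
  congrArg ENNReal.toReal
    (h.measure_mem_eq (s := {x | t < |x|}) (measurableSet_lt measurable_const measurable_abs))

/-! ### Exponential bounds for truncated sums -/

section

variable {Ω : Type*} [MeasurableSpace Ω] {P : Measure Ω} [IsProbabilityMeasure P]

lemma integrable_of_abs_le {Y : Ω → ℝ} (hY : Measurable Y) {b : ℝ} (hb : ∀ ω, |Y ω| ≤ b) :
    Integrable Y P :=
  Integrable.of_bound hY.aestronglyMeasurable b (Eventually.of_forall hb)

lemma integrable_trunc {X : Ω → ℝ} (hX : Measurable X) {b : ℝ} (hb : 0 ≤ b) :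
    Integrable (fun ω => trunc b (X ω)) P :=
  integrable_of_abs_le ((measurable_trunc b).comp hX) fun ω => abs_trunc_le hb (X ω)

lemma exp_le_one_add_add_sq {x : ℝ} (hx : |x| ≤ 1) : Real.exp x ≤ 1 + x + x ^ 2 := by
  have := (abs_le.1 (Real.abs_exp_sub_one_sub_id_le hx)).2
  linarith

lemma integrable_exp_mul_of_abs_le {Y : Ω → ℝ} (hY : Measurable Y) {l b : ℝ}
    (hb : ∀ ω, |Y ω| ≤ b) : Integrable (fun ω => Real.exp (l * Y ω)) P := by
  refine Integrable.of_bound (by fun_prop) (Real.exp (|l| * b)) (Eventually.of_forall fun ω => ?_)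
  rw [Real.norm_eq_abs, Real.abs_exp, Real.exp_le_exp]
  calc l * Y ω ≤ |l * Y ω| := le_abs_self _
    _ = |l| * |Y ω| := abs_mul _ _
    _ ≤ |l| * b := mul_le_mul_of_nonneg_left (hb ω) (abs_nonneg _)

/-- The moment generating function of a bounded variable in the range where it is controlled by
the first two moments. -/
lemma mgf_le_of_abs_le {Y : Ω → ℝ} (hY : Measurable Y) {l b : ℝ} (hb : ∀ ω, |Y ω| ≤ b)
    (hl : |l| * b ≤ 1) :
    mgf Y P l ≤ Real.exp (|l| * |∫ ω, Y ω ∂P| + l ^ 2 * ∫ ω, Y ω ^ 2 ∂P) := by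
  have hi : Integrable Y P := integrable_of_abs_le hY hb
  have hi2 : Integrable (fun ω => Y ω ^ 2) P := by
    refine integrable_of_abs_le (b := b ^ 2) (by fun_prop) fun ω => ?_
    rw [abs_pow]; exact pow_le_pow_left₀ (abs_nonneg _) (hb ω) 2
  have h1 : mgf Y P l ≤ ∫ ω, (1 + l * Y ω + l ^ 2 * Y ω ^ 2) ∂P := by
    refine integral_mono (integrable_exp_mul_of_abs_le hY hb)
      (((integrable_const _).add (hi.const_mul _)).add (hi2.const_mul _)) fun ω => ?_
    have : |l * Y ω| ≤ 1 := by
      rw [abs_mul]; exact (mul_le_mul_of_nonneg_left (hb ω) (abs_nonneg _)).trans hl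
    have := exp_le_one_add_add_sq this
    simp only
    linarith [mul_pow l (Y ω) 2]
  have h2 : ∫ ω, (1 + l * Y ω + l ^ 2 * Y ω ^ 2) ∂P
      = 1 + l * ∫ ω, Y ω ∂P + l ^ 2 * ∫ ω, Y ω ^ 2 ∂P := by
    rw [integral_add (f := fun ω => 1 + l * Y ω) ((integrable_const _).add (hi.const_mul _))
      (hi2.const_mul _), integral_add (integrable_const _) (hi.const_mul _), integral_const_mul,
      integral_const_mul]
    simp
  have h3 : l * ∫ ω, Y ω ∂P ≤ |l| * |∫ ω, Y ω ∂P| := (le_abs_self _).trans (abs_mul _ _).le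
  have h4 := Real.add_one_le_exp (|l| * |∫ ω, Y ω ∂P| + l ^ 2 * ∫ ω, Y ω ^ 2 ∂P)
  linarith

/-- A Chernoff bound for sums of truncated variables. -/
lemma measureReal_lt_abs_sum_trunc_le {ι : Type*} {X : Ω → ℝ} {Xs : ι → Ω → ℝ} (hX : Measurable X)
    (hXs : ∀ i, Measurable (Xs i)) (hindep : iIndepFun Xs P)
    (hident : ∀ i, IdentDistrib (Xs i) X P P) (F : Finset ι) {b l t : ℝ} (hb : 0 ≤ b)
    (hl : 0 ≤ l) (hlb : l * b ≤ 1) :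
    P.real {ω | t < |∑ i ∈ F, trunc b (Xs i ω)|} ≤
      2 * Real.exp (-(l * t) + F.card * (l * |∫ ω, trunc b (X ω) ∂P|
        + l ^ 2 * ∫ ω, trunc b (X ω) ^ 2 ∂P)) := by
  set Y : ι → Ω → ℝ := fun i => trunc b ∘ Xs i with hYdef
  set M : ℝ := F.card * (l * |∫ ω, trunc b (X ω) ∂P| + l ^ 2 * ∫ ω, trunc b (X ω) ^ 2 ∂P) with hM
  have hYm : ∀ i, Measurable (Y i) := fun i => (measurable_trunc b).comp (hXs i)
  have hYi : iIndepFun Y P := hindep.comp (fun _ => trunc b) fun _ => measurable_trunc b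
  have hSm : Measurable (∑ i ∈ F, Y i) := by
    have := Finset.measurable_sum F fun i _ => hYm i
    convert this using 1
    ext ω; simp
  have hSb : ∀ ω, |(∑ i ∈ F, Y i) ω| ≤ F.card * b := fun ω => by
    rw [Finset.sum_apply]
    calc |∑ i ∈ F, Y i ω| ≤ ∑ i ∈ F, |Y i ω| := Finset.abs_sum_le_sum_abs _ _
      _ ≤ ∑ i ∈ F, b := Finset.sum_le_sum fun i _ => abs_trunc_le hb _
      _ = F.card * b := by simp
  -- Both signs are needed, one for each tail of the sum; the bound sees the mean only through its
  -- absolute value.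
  have hmgf : ∀ l' : ℝ, |l'| = l → mgf (∑ i ∈ F, Y i) P l' ≤
      Real.exp M := by
    intro l' hl'
    rw [hM, hYi.mgf_sum hYm, Real.exp_nat_mul, ← Finset.prod_const]
    refine Finset.prod_le_prod (fun i _ => mgf_nonneg) fun i _ => ?_
    rw [mgf_congr_identDistrib ((hident i).comp (measurable_trunc b))]
    have := mgf_le_of_abs_le (P := P) (Y := trunc b ∘ X) (l := l')
      ((measurable_trunc b).comp hX) (fun ω => abs_trunc_le hb (X ω)) (by rwa [hl'])
    rwa [hl', ← sq_abs, hl'] at this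
  have h1 := measure_ge_le_exp_mul_mgf (X := ∑ i ∈ F, Y i) (μ := P) t hl
    (integrable_exp_mul_of_abs_le hSm hSb)
  have h2 := measure_le_le_exp_mul_mgf (X := ∑ i ∈ F, Y i) (μ := P) (-t) (neg_nonpos.2 hl)
    (integrable_exp_mul_of_abs_le hSm hSb)
  have h3 := hmgf l (abs_of_nonneg hl)
  have h4 := hmgf (-l) (by rw [abs_neg, abs_of_nonneg hl])
  have hsub : {ω | t < |∑ i ∈ F, trunc b (Xs i ω)|} ⊆
      {ω | t ≤ (∑ i ∈ F, Y i) ω} ∪ {ω | (∑ i ∈ F, Y i) ω ≤ -t} := by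
    intro ω hω
    simp only [Set.mem_ofPred_eq, Set.mem_union, Finset.sum_apply, hYdef, Function.comp] at hω ⊢
    rcases lt_abs.1 hω with h | h
    · exact Or.inl h.le
    · exact Or.inr (by linarith)
  calc P.real {ω | t < |∑ i ∈ F, trunc b (Xs i ω)|}
      ≤ P.real {ω | t ≤ (∑ i ∈ F, Y i) ω} + P.real {ω | (∑ i ∈ F, Y i) ω ≤ -t} :=
        (measureReal_mono hsub).trans (measureReal_union_le _ _)
    _ ≤ Real.exp (-l * t) * Real.exp M + Real.exp (-l * t) * Real.exp M := by
        refine add_le_add (h1.trans (mul_le_mul_of_nonneg_left h3 (Real.exp_nonneg _)))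
          (h2.trans ?_)
        rw [neg_neg, mul_neg, ← neg_mul]
        exact mul_le_mul_of_nonneg_left h4 (Real.exp_nonneg _)
    _ = _ := by rw [Real.exp_add, neg_mul]; ring

/-- A Chernoff bound for sums of independent variables after truncation at level `b`. -/
lemma measureReal_lt_abs_sum_le {ι : Type*} {X : Ω → ℝ} {Xs : ι → Ω → ℝ} (hX : Measurable X)
    (hXs : ∀ i, Measurable (Xs i)) (hindep : iIndepFun Xs P)
    (hident : ∀ i, IdentDistrib (Xs i) X P P) (F : Finset ι) {n : ℕ} (hF : F.card ≤ n)
    {b l t : ℝ} (hb : 0 ≤ b) (hl : 0 ≤ l) (hlb : l * b ≤ 1) :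
    P.real {ω | t < |∑ i ∈ F, Xs i ω|} ≤ n * P.real {ω | b < |X ω|} +
      2 * Real.exp (-(l * t) + n * (l * |∫ ω, trunc b (X ω) ∂P|
        + l ^ 2 * ∫ ω, trunc b (X ω) ^ 2 ∂P)) := by
  have hF' : (F.card : ℝ) ≤ n := by exact_mod_cast hF
  have hsub : {ω | t < |∑ i ∈ F, Xs i ω|} ⊆
      (⋃ i ∈ F, {ω | b < |Xs i ω|}) ∪ {ω | t < |∑ i ∈ F, trunc b (Xs i ω)|} := by
    intro ω hω
    by_cases h : ∃ i ∈ F, b < |Xs i ω|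
    · left; simpa using h
    · right
      push Not at h
      have : ∑ i ∈ F, trunc b (Xs i ω) = ∑ i ∈ F, Xs i ω :=
        Finset.sum_congr rfl fun i hi => if_pos (h i hi)
      simpa [this] using hω
  have hU : P.real (⋃ i ∈ F, {ω | b < |Xs i ω|}) ≤ n * P.real {ω | b < |X ω|} := by
    calc P.real (⋃ i ∈ F, {ω | b < |Xs i ω|}) ≤ ∑ i ∈ F, P.real {ω | b < |Xs i ω|} :=
          measureReal_biUnion_finset_le _ _
      _ = F.card * P.real {ω | b < |X ω|} := by
          rw [Finset.sum_congr rfl fun i _ => identDistrib_measureReal_lt_abs (hident i) b]; simp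
      _ ≤ _ := mul_le_mul_of_nonneg_right hF' measureReal_nonneg
  refine (measureReal_mono hsub).trans ((measureReal_union_le _ _).trans (add_le_add hU ?_))
  refine (measureReal_lt_abs_sum_trunc_le hX hXs hindep hident F hb hl hlb).trans ?_
  have h0 : 0 ≤ l * |∫ ω, trunc b (X ω) ∂P| + l ^ 2 * ∫ ω, trunc b (X ω) ^ 2 ∂P := by
    have : 0 ≤ ∫ ω, trunc b (X ω) ^ 2 ∂P := integral_nonneg fun _ => sq_nonneg _
    positivity
  gcongr

end

/-! ### Truncated moments and tail expectations from tail bounds -/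

lemma integral_le_of_lintegral_ofReal_le {Ω : Type*} [MeasurableSpace Ω] {P : Measure Ω}
    {f : Ω → ℝ} (hf : Measurable f) (h0 : ∀ ω, 0 ≤ f ω) {c : ℝ} (hc : 0 ≤ c)
    (h : ∫⁻ ω, ENNReal.ofReal (f ω) ∂P ≤ ENNReal.ofReal c) :
    ∫ ω, f ω ∂P ≤ c := by
  rw [integral_eq_lintegral_of_nonneg_ae (Eventually.of_forall h0) hf.aestronglyMeasurable]
  exact ENNReal.toReal_le_of_le_ofReal hc h

section

variable {Ω : Type*} [MeasurableSpace Ω] {P : Measure Ω} [IsProbabilityMeasure P]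

/-- Absolute moments of a truncated variable with tails `O(t ^ (-p))`. -/
lemma integral_abs_trunc_rpow_le {X : Ω → ℝ} (hX : Measurable X) {p r C b : ℝ} (hC : 0 ≤ C)
    (hr : 0 < r) (hpr : p < r) (hb : 0 < b)
    (htail : ∀ t : ℝ, 0 < t → P.real {ω | t < |X ω|} ≤ C * t ^ (-p)) :
    ∫ ω, |trunc b (X ω)| ^ r ∂P ≤ r * C / (r - p) * b ^ (r - p) := by
  have hrp : 0 < r - p := sub_pos.2 hpr
  have hm : Measurable fun ω => |trunc b (X ω)| := ((measurable_trunc b).comp hX).abs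
  refine integral_le_of_lintegral_ofReal_le (hm.pow_const r)
    (fun ω => Real.rpow_nonneg (abs_nonneg _) _) (by positivity) ?_
  rw [lintegral_rpow_eq_lintegral_meas_lt_mul P (Eventually.of_forall fun ω => abs_nonneg _)
    hm.aemeasurable hr]
  have hint : IntegrableOn (fun t : ℝ => C * t ^ (r - p - 1)) (Set.Ioc 0 b) := by
    have := (intervalIntegral.intervalIntegrable_rpow' (a := 0) (b := b) (r := r - p - 1)
      (by linarith)).const_mul C
    exact (intervalIntegrable_iff_integrableOn_Ioc_of_le hb.le).1 this
  have hval : ∫⁻ t in Set.Ioc 0 b, ENNReal.ofReal (C * t ^ (r - p - 1))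
      = ENNReal.ofReal (C / (r - p) * b ^ (r - p)) := by
    rw [← ofReal_integral_eq_lintegral_ofReal hint, ← intervalIntegral.integral_of_le hb.le,
      intervalIntegral.integral_const_mul, integral_rpow (Or.inl (by linarith))]
    · rw [sub_add_cancel, Real.zero_rpow hrp.ne', sub_zero]; congr 1; ring
    · refine (ae_restrict_iff' measurableSet_Ioc).2 (Eventually.of_forall fun t ht => ?_)
      have := Real.rpow_nonneg ht.1.le (r - p - 1)
      simp only [Pi.zero_apply]; positivity
  calc _ ≤ ENNReal.ofReal r * ENNReal.ofReal (C / (r - p) * b ^ (r - p)) := by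
        gcongr
        rw [← hval, ← lintegral_indicator measurableSet_Ioi,
          ← lintegral_indicator measurableSet_Ioc]
        refine lintegral_mono fun t => ?_
        by_cases ht0 : 0 < t
        swap
        · simp [ht0]
        by_cases htb : t ≤ b
        · rw [Set.indicator_of_mem (Set.mem_Ioi.2 ht0), Set.indicator_of_mem (Set.mem_Ioc.2 ⟨ht0, htb⟩)]
          have h1 : P {ω | t < |trunc b (X ω)|} ≤ ENNReal.ofReal (C * t ^ (-p)) := by
            rw [← ofReal_measureReal]
            refine ENNReal.ofReal_le_ofReal ((measureReal_mono fun ω hω => ?_).trans (htail t ht0))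
            exact lt_of_lt_of_le hω (abs_trunc_le_abs _ _)
          refine (mul_le_mul_left h1 _).trans ?_
          rw [← ENNReal.ofReal_mul (by positivity), mul_assoc, ← Real.rpow_add ht0]
          apply le_of_eq; congr 3; ring
        · have : {ω | t < |trunc b (X ω)|} = ∅ := by
            ext ω; simpa using (abs_trunc_le hb.le _).trans (not_le.1 htb).le
          rw [Set.indicator_of_mem (Set.mem_Ioi.2 ht0), this]; simp
    _ = _ := by rw [← ENNReal.ofReal_mul hr.le]; congr 1; ring

/-- The tail expectation of an integrable variable with tails at most `ε * t ^ (-p)` beyond `T`. -/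
lemma integral_tail_le {X : Ω → ℝ} (hX : Measurable X) {p ε T : ℝ} (hε : 0 ≤ ε) (hp : 1 < p)
    (hT : 0 < T) (htail : ∀ t : ℝ, T ≤ t → P.real {ω | t < |X ω|} ≤ ε * t ^ (-p)) :
    ∫ ω, |X ω - trunc T (X ω)| ∂P ≤ ε * (1 + 1 / (p - 1)) * T ^ (1 - p) := by
  have hp1 : 0 < p - 1 := sub_pos.2 hp
  have hm : Measurable fun ω => |X ω - trunc T (X ω)| :=
    (hX.sub ((measurable_trunc T).comp hX)).abs
  have habs : ∀ ω, ∀ t : ℝ, 0 < t → t < |X ω - trunc T (X ω)| → T < |X ω| ∧ t < |X ω| := by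
    intro ω t ht h
    unfold trunc at h
    split_ifs at h with h1
    · simp at h; linarith
    · exact ⟨not_le.1 h1, by simpa using h⟩
  refine integral_le_of_lintegral_ofReal_le hm (fun ω => abs_nonneg _) (by positivity) ?_
  -- The layer-cake integral is split at `T`: a nonzero value of `X - trunc T X` already forces `|X|
  -- > T`, so below `T` the tail at `T` serves for every `t`.
  rw [lintegral_eq_lintegral_meas_lt P (Eventually.of_forall fun ω => abs_nonneg _)
    hm.aemeasurable, ← Set.Ioc_union_Ioi_eq_Ioi hT.le,
    lintegral_union measurableSet_Ioi (by
      rw [Set.disjoint_left]; exact fun x hx hx' => absurd hx.2 (not_le.2 hx'))]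
  have h1 : ∫⁻ t in Set.Ioc 0 T, P {ω | t < |X ω - trunc T (X ω)|}
      ≤ ENNReal.ofReal (ε * T ^ (1 - p)) := by
    calc _ ≤ ∫⁻ t in Set.Ioc 0 T, ENNReal.ofReal (ε * T ^ (-p)) := by
          refine setLIntegral_mono measurable_const fun t ht => ?_
          rw [← ofReal_measureReal]
          exact ENNReal.ofReal_le_ofReal ((measureReal_mono fun ω hω =>
            (habs ω t ht.1 hω).1).trans (htail T le_rfl))
      _ = _ := by
          rw [setLIntegral_const, Real.volume_Ioc, ← ENNReal.ofReal_mul (by positivity)]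
          congr 1
          rw [sub_zero, mul_assoc, ← Real.rpow_add_one hT.ne']; congr 2; ring
  have h2 : ∫⁻ t in Set.Ioi T, P {ω | t < |X ω - trunc T (X ω)|}
      ≤ ENNReal.ofReal (ε * (1 / (p - 1)) * T ^ (1 - p)) := by
    calc _ ≤ ∫⁻ t in Set.Ioi T, ENNReal.ofReal (ε * t ^ (-p)) := by
          refine setLIntegral_mono (by fun_prop) fun t ht => ?_
          rw [← ofReal_measureReal]
          exact ENNReal.ofReal_le_ofReal ((measureReal_mono fun ω hω =>
            (habs ω t (hT.trans ht) hω).2).trans (htail t (le_of_lt ht)))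
      _ = _ := by
          rw [← ofReal_integral_eq_lintegral_ofReal
            ((integrableOn_Ioi_rpow_of_lt (by linarith) hT).const_mul ε), integral_const_mul,
            integral_Ioi_rpow_of_lt (by linarith) hT]
          · congr 1
            rw [show -p + 1 = -(p - 1) by ring, show 1 - p = -(p - 1) by ring, neg_div_neg_eq]
            ring
          · refine (ae_restrict_iff' measurableSet_Ioi).2 (Eventually.of_forall fun t ht => ?_)
            have := Real.rpow_nonneg (hT.trans ht).le (-p)
            simp only [Pi.zero_apply]; positivity
  refine (add_le_add h1 h2).trans (le_of_eq ?_)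
  rw [← ENNReal.ofReal_add (by positivity) (by positivity)]
  congr 1; ring

end

/-! ### Tails and truncated means under the weak law conditions -/

lemma eventually_mul_natCast_rpow_le {x y ε : ℝ} (hxy : x < y) (hε : 0 < ε) (K : ℝ) :
    ∀ᶠ n : ℕ in atTop, K * (n : ℝ) ^ x ≤ ε * (n : ℝ) ^ y := by
  have h1 : Tendsto (fun n : ℕ => ε * (n : ℝ) ^ (y - x)) atTop atTop :=
    ((tendsto_rpow_atTop (sub_pos.2 hxy)).comp tendsto_natCast_atTop_atTop).const_mul_atTop hε
  filter_upwards [h1.eventually_ge_atTop K, eventually_gt_atTop 0] with n hn hn0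
  have hn0' : (0 : ℝ) < n := by exact_mod_cast hn0
  calc K * (n : ℝ) ^ x ≤ ε * (n : ℝ) ^ (y - x) * (n : ℝ) ^ x :=
        mul_le_mul_of_nonneg_right hn (Real.rpow_nonneg hn0'.le _)
    _ = ε * (n : ℝ) ^ y := by rw [mul_assoc, ← Real.rpow_add hn0', sub_add_cancel]

lemma WeakLawCondition.tendsto_tail {Ω : Type*} [MeasurableSpace Ω] {P : Measure Ω}
    {X : Ω → ℝ} {p : ℝ} (h : WeakLawCondition P X p) :
    Tendsto (fun n : ℕ => (n : ℝ) * P.real {ω | (n : ℝ) ^ (1 / p) < |X ω|}) atTop (𝓝 0) := by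
  rcases lt_trichotomy p 1 with h1 | h1 | h1
  · exact h.1 h1
  · refine squeeze_zero (fun n => by positivity) (fun n => ?_) (h.2.1 h1)
    subst h1
    simp
  · exact (h.2.2 h1).2

section

variable {Ω : Type*} [MeasurableSpace Ω] {P : Measure Ω} [IsProbabilityMeasure P]

/-- Interpolates between the levels `n^{1/p}`: with `n = ⌊t^p⌋` one has `t^p ≤ 2n`, which costs a
factor 2 and explains the use of `ε / 2`. -/
lemma exists_tail_le_of_tendsto {X : Ω → ℝ} {p ε : ℝ} (hp : 0 < p) (hε : 0 < ε)
    (h : Tendsto (fun n : ℕ => (n : ℝ) * P.real {ω | (n : ℝ) ^ (1 / p) < |X ω|}) atTop (𝓝 0)) :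
    ∃ T : ℝ, 0 < T ∧ ∀ t : ℝ, T ≤ t → P.real {ω | t < |X ω|} ≤ ε * t ^ (-p) := by
  obtain ⟨N, hN⟩ := eventually_atTop.1 (h.eventually_le_const (half_pos hε))
  refine ⟨((N + 1 : ℕ) : ℝ) ^ (1 / p), by positivity, fun t ht => ?_⟩
  have hT0 : (0 : ℝ) < ((N + 1 : ℕ) : ℝ) ^ (1 / p) := by positivity
  have ht0 : 0 < t := hT0.trans_le ht
  have htp : ((N + 1 : ℕ) : ℝ) ≤ t ^ p := by
    have := Real.rpow_le_rpow hT0.le ht hp.le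
    rwa [← Real.rpow_mul (by positivity), one_div_mul_cancel hp.ne', Real.rpow_one] at this
  set n := ⌊t ^ p⌋₊ with hn
  have hnN : N + 1 ≤ n := Nat.le_floor htp
  have hnle : (n : ℝ) ≤ t ^ p := Nat.floor_le (by positivity)
  have hnge : t ^ p < n + 1 := Nat.lt_floor_add_one _
  have hn1 : (1 : ℝ) ≤ n := by exact_mod_cast (by omega : 1 ≤ n)
  have hnt : (n : ℝ) ^ (1 / p) ≤ t := by
    have := Real.rpow_le_rpow (by positivity) hnle (one_div_pos.2 hp).le
    rwa [← Real.rpow_mul ht0.le, mul_one_div_cancel hp.ne', Real.rpow_one] at this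
  have h1 : P.real {ω | t < |X ω|} ≤ P.real {ω | (n : ℝ) ^ (1 / p) < |X ω|} :=
    measureReal_mono fun ω hω => lt_of_le_of_lt hnt hω
  have h2 := hN n (by omega)
  have htp0 : 0 < t ^ p := Real.rpow_pos_of_pos ht0 p
  rw [Real.rpow_neg ht0.le, ← div_eq_mul_inv, le_div_iff₀ htp0]
  calc P.real {ω | t < |X ω|} * t ^ p
      ≤ P.real {ω | (n : ℝ) ^ (1 / p) < |X ω|} * (2 * n) := by
        gcongr; linarith
    _ ≤ ε := by linarith

lemma exists_tail_bound_of_tendsto {X : Ω → ℝ} {p : ℝ} (hp : 0 < p)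
    (h : Tendsto (fun n : ℕ => (n : ℝ) * P.real {ω | (n : ℝ) ^ (1 / p) < |X ω|}) atTop (𝓝 0)) :
    ∃ C : ℝ, 0 < C ∧ ∀ t : ℝ, 0 < t → P.real {ω | t < |X ω|} ≤ C * t ^ (-p) := by
  obtain ⟨T, hT, hT'⟩ := exists_tail_le_of_tendsto hp one_pos h
  refine ⟨1 + T ^ p, by positivity, fun t ht => ?_⟩
  have htp := Real.rpow_pos_of_pos ht (-p)
  have hTp := Real.rpow_pos_of_pos hT p
  rcases le_total T t with hTt | htT
  · refine (hT' t hTt).trans ?_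
    gcongr; linarith
  · refine measureReal_le_one.trans ?_
    have : 1 ≤ T ^ p * t ^ (-p) := by
      rw [Real.rpow_neg ht.le, ← div_eq_mul_inv, one_le_div (Real.rpow_pos_of_pos ht p)]
      exact Real.rpow_le_rpow ht.le htT hp.le
    nlinarith

lemma abs_integral_trunc_le {X : Ω → ℝ} (hX : Measurable X) {p C b : ℝ} (hC : 0 ≤ C)
    (hp : p < 1) (hb : 0 < b)
    (htail : ∀ t : ℝ, 0 < t → P.real {ω | t < |X ω|} ≤ C * t ^ (-p)) :
    |∫ ω, trunc b (X ω) ∂P| ≤ C / (1 - p) * b ^ (1 - p) := by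
  have := integral_abs_trunc_rpow_le hX hC one_pos hp hb htail
  simp only [Real.rpow_one, one_mul] at this
  exact (abs_integral_le_integral_abs).trans this

lemma integral_trunc_sq_le {X : Ω → ℝ} (hX : Measurable X) {p C b : ℝ} (hC : 0 ≤ C)
    (hp : p < 2) (hb : 0 < b)
    (htail : ∀ t : ℝ, 0 < t → P.real {ω | t < |X ω|} ≤ C * t ^ (-p)) :
    ∫ ω, trunc b (X ω) ^ 2 ∂P ≤ 2 * C / (2 - p) * b ^ (2 - p) := by
  have := integral_abs_trunc_rpow_le hX hC two_pos hp hb htail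
  simpa only [Real.rpow_two, sq_abs] using this

/-- For `1 ≤ p` the normalized truncated mean vanishes in the limit. -/
lemma WeakLawCondition.eventually_mean_le {X : Ω → ℝ} (hX : Measurable X) {p : ℝ} (hp : 1 ≤ p)
    (h : WeakLawCondition P X p) {ε : ℝ} (hε : 0 < ε) :
    ∀ᶠ n : ℕ in atTop,
      n * |∫ ω, trunc ((n : ℝ) ^ (1 / p)) (X ω) ∂P| ≤ ε * (n : ℝ) ^ (1 / p) := by
  rcases hp.eq_or_lt with h1 | h1
  · subst h1
    filter_upwards [(h.2.1 rfl).eventually_le_const hε] with n hn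
    have : ∫ ω, trunc ((n : ℝ) ^ (1 / 1 : ℝ)) (X ω) ∂P = ∫ ω in {ω | |X ω| ≤ (n : ℝ)}, X ω ∂P := by
      rw [← integral_indicator (measurableSet_le hX.abs measurable_const)]
      congr 1; ext ω
      simp [trunc, Set.indicator]
    rw [this]
    have h0 : 0 ≤ (n : ℝ) * P.real {ω | (n : ℝ) < |X ω|} := by positivity
    simp only [div_one, Real.rpow_one]
    rw [mul_comm ε]
    gcongr
    linarith
  · have hp0 : 0 < p := one_pos.trans h1
    have hp1 : 0 < p - 1 := sub_pos.2 h1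
    obtain ⟨⟨hint, hmean⟩, htend⟩ := h.2.2 h1
    obtain ⟨T, hT, hT'⟩ := exists_tail_le_of_tendsto hp0
      (ε := ε / (1 + 1 / (p - 1))) (by positivity) htend
    have hlim : Tendsto (fun n : ℕ => (n : ℝ) ^ (1 / p)) atTop atTop :=
      (tendsto_rpow_atTop (by positivity)).comp tendsto_natCast_atTop_atTop
    filter_upwards [hlim.eventually_ge_atTop T, eventually_gt_atTop 0] with n hn hn0
    have hn0' : (0 : ℝ) < n := by exact_mod_cast hn0
    set a := (n : ℝ) ^ (1 / p) with ha
    have ha0 : 0 < a := by positivity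
    have hna : (n : ℝ) = a ^ p := by
      rw [ha, ← Real.rpow_mul hn0'.le, one_div_mul_cancel hp0.ne', Real.rpow_one]
    have h2 := integral_tail_le hX (ε := ε / (1 + 1 / (p - 1))) (by positivity) h1 ha0
      fun t ht => hT' t (hn.trans ht)
    rw [div_mul_cancel₀ _ (by positivity)] at h2
    have h3 : |∫ ω, trunc a (X ω) ∂P| ≤ ε * a ^ (1 - p) := by
      refine le_trans ?_ h2
      -- Since `X` is centred, the truncated mean is minus the mean of the discarded part.
      have : ∫ ω, (X ω - trunc a (X ω)) ∂P = - ∫ ω, trunc a (X ω) ∂P := by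
        rw [integral_sub hint (integrable_trunc hX ha0.le), hmean, zero_sub]
      rw [← abs_neg, ← this]
      exact abs_integral_le_integral_abs
    calc n * |∫ ω, trunc a (X ω) ∂P| ≤ n * (ε * a ^ (1 - p)) := by gcongr
      _ = ε * (a ^ p * a ^ (1 - p)) := by rw [hna]; ring
      _ = ε * a := by rw [← Real.rpow_add ha0]; simp

lemma natCast_mul_rpow_rpow {n : ℕ} (hn : 0 < n) (x y : ℝ) :
    (n : ℝ) * ((n : ℝ) ^ x) ^ y = (n : ℝ) ^ (1 + x * y) := by
  have hn0 : (0 : ℝ) < n := by exact_mod_cast hn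
  rw [← Real.rpow_mul hn0.le, Real.rpow_add hn0, Real.rpow_one]

/-- For `p < 1` no centring is needed: the first absolute moment truncated at `a = n^{1/p}` is
`O(a^{1-p})`, and `n = a^p`. Boundedness is all that the lower bound requires. -/
lemma WeakLawCondition.exists_mean_bound {X : Ω → ℝ} (hX : Measurable X) {p : ℝ} (hp : 0 < p)
    (h : WeakLawCondition P X p) :
    ∃ K : ℝ, 0 ≤ K ∧ ∀ᶠ n : ℕ in atTop,
      n * |∫ ω, trunc ((n : ℝ) ^ (1 / p)) (X ω) ∂P| ≤ K * (n : ℝ) ^ (1 / p) := by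
  rcases lt_or_ge p 1 with h1 | h1
  · obtain ⟨C, hC, hC'⟩ := exists_tail_bound_of_tendsto hp h.tendsto_tail
    have hp1 : 0 < 1 - p := sub_pos.2 h1
    refine ⟨C / (1 - p), by positivity, ?_⟩
    filter_upwards [eventually_gt_atTop 0] with n hn0
    have hn0' : (0 : ℝ) < n := by exact_mod_cast hn0
    calc _ ≤ (n : ℝ) * (C / (1 - p) * ((n : ℝ) ^ (1 / p)) ^ (1 - p)) := by
          gcongr
          exact abs_integral_trunc_le hX hC.le h1 (by positivity) hC'
      _ = C / (1 - p) * (n * ((n : ℝ) ^ (1 / p)) ^ (1 - p)) := by ring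
      _ = _ := by
          rw [natCast_mul_rpow_rpow hn0]; congr 2; field_simp; ring
  · exact ⟨1, zero_le_one, h.eventually_mean_le hX h1 one_pos⟩

/-- The two truncations differ only where `|X| > b`; there the lower one is zero and the higher one
is at most `a` in absolute value. -/
lemma abs_integral_trunc_sub_le {X : Ω → ℝ} (hX : Measurable X) {a b : ℝ} (hb : 0 ≤ b)
    (hba : b ≤ a) :
    |∫ ω, trunc b (X ω) ∂P| ≤
      |∫ ω, trunc a (X ω) ∂P| + a * P.real {ω | b < |X ω|} := by
  have ha := hb.trans hba
  have hm : MeasurableSet {ω | b < |X ω|} := measurableSet_lt measurable_const hX.abs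
  have h1 : |∫ ω, trunc b (X ω) ∂P - ∫ ω, trunc a (X ω) ∂P| ≤ a * P.real {ω | b < |X ω|} := by
    rw [← integral_sub (integrable_trunc hX hb) (integrable_trunc hX ha)]
    refine abs_integral_le_integral_abs.trans ?_
    have : ∫ ω, Set.indicator {ω | b < |X ω|} (fun _ => a) ω ∂P = a * P.real {ω | b < |X ω|} := by
      rw [integral_indicator_const _ hm, smul_eq_mul, mul_comm]
    rw [← this]
    refine integral_mono ((integrable_trunc hX hb).sub (integrable_trunc hX ha)).abs
      ((integrable_const a).indicator hm) fun ω => ?_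
    by_cases hω : b < |X ω|
    · simp only [Set.indicator, Set.mem_ofPred_eq, hω, if_true]
      have : trunc b (X ω) = 0 := if_neg (not_le.2 hω)
      rw [this, zero_sub, abs_neg]
      exact abs_trunc_le ha _
    · simp only [Set.indicator, Set.mem_ofPred_eq, hω, if_false]
      simp [trunc, not_lt.1 hω, (not_lt.1 hω).trans hba]
  have := abs_sub_abs_le_abs_sub (∫ ω, trunc b (X ω) ∂P) (∫ ω, trunc a (X ω) ∂P)
  linarith

/-- The mean after truncation at the lower level `n ^ (k / p)`, `k < 1`. -/
lemma WeakLawCondition.eventually_mean_low_le {X : Ω → ℝ} (hX : Measurable X) {p : ℝ} (hp : 0 < p)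
    (h : WeakLawCondition P X p) {k ε : ℝ} (hk : k < 1) (hε : 0 < ε) :
    ∀ᶠ n : ℕ in atTop,
      n * |∫ ω, trunc ((n : ℝ) ^ (k / p)) (X ω) ∂P| ≤
        ε * (n : ℝ) ^ (1 / p) + (n : ℝ) ^ (1 / p) * (n * P.real {ω | (n : ℝ) ^ (k / p) < |X ω|}) := by
  rcases lt_or_ge p 1 with h1 | h1
  · obtain ⟨C, hC, hC'⟩ := exists_tail_bound_of_tendsto hp h.tendsto_tail
    have hp1 : 0 < 1 - p := sub_pos.2 h1
    -- For `p < 1` the lower truncation gains the power `(1 - k)(1 - p) / p` of `n`, so the mean is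
    -- negligible by itself.
    have hexp : 1 + k / p * (1 - p) < 1 / p := by
      have : 1 / p - (1 + k / p * (1 - p)) = (1 - k) * (1 - p) / p := by field_simp; ring
      have : 0 < (1 - k) * (1 - p) / p := div_pos (mul_pos (sub_pos.2 hk) hp1) hp
      linarith
    filter_upwards [eventually_gt_atTop 0,
      eventually_mul_natCast_rpow_le hexp hε (C / (1 - p))] with n hn0 hn
    have hn0' : (0 : ℝ) < n := by exact_mod_cast hn0
    have h0 : 0 ≤ (n : ℝ) ^ (1 / p) * (n * P.real {ω | (n : ℝ) ^ (k / p) < |X ω|}) := by positivity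
    calc _ ≤ (n : ℝ) * (C / (1 - p) * ((n : ℝ) ^ (k / p)) ^ (1 - p)) := by
          gcongr
          exact abs_integral_trunc_le hX hC.le h1 (by positivity) hC'
      _ = C / (1 - p) * (n * ((n : ℝ) ^ (k / p)) ^ (1 - p)) := by ring
      _ ≤ ε * (n : ℝ) ^ (1 / p) := by rw [natCast_mul_rpow_rpow hn0]; exact hn
      _ ≤ _ := le_add_of_nonneg_right h0
  · filter_upwards [eventually_gt_atTop 0, h.eventually_mean_le hX h1 hε] with n hn0 hn
    have hn1 : (1 : ℝ) ≤ n := by exact_mod_cast hn0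
    have := abs_integral_trunc_sub_le (P := P) hX (a := (n : ℝ) ^ (1 / p)) (b := (n : ℝ) ^ (k / p))
      (by positivity) (Real.rpow_le_rpow_of_exponent_le hn1 (by gcongr))
    calc _ ≤ (n : ℝ) * (|∫ ω, trunc ((n : ℝ) ^ (1 / p)) (X ω) ∂P| +
          (n : ℝ) ^ (1 / p) * P.real {ω | (n : ℝ) ^ (k / p) < |X ω|}) := by gcongr
      _ ≤ _ := by linarith

end

/-! ### Comparison of the deviation probability with the tail of one summand -/

section

variable {Ω : Type*} [MeasurableSpace Ω] {P : Measure Ω} [IsProbabilityMeasure P]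

/-- Upper bound: a union bound at the level `n ^ (k / p)` and a negligible remainder. -/
lemma WeakLawCondition.exists_upper_bound {X : Ω → ℝ} {Xs : ℕ → Ω → ℝ} {p : ℝ}
    (h : WeakLawCondition P X p) (hp0 : 0 < p) (hp2 : p < 2) (hX : Measurable X)
    (hXs : ∀ n, Measurable (Xs n)) (hindep : iIndepFun Xs P)
    (hident : ∀ n, IdentDistrib (Xs n) X P P) {s k : ℝ} (hs : 0 < s) (hk1 : k < 1) :
    ∃ C D δ e : ℝ, 0 < C ∧ 0 < D ∧ 0 < δ ∧ 0 < e ∧ ∀ᶠ n : ℕ in atTop,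
      P.real {ω | s * (n : ℝ) ^ (1 / p) < |partialSum Xs n ω|} ≤
        C * (n * P.real {ω | (n : ℝ) ^ (k / p) < |X ω|}) + D * Real.exp (-(δ * (n : ℝ) ^ e)) := by
  obtain ⟨C, hC, hC'⟩ := exists_tail_bound_of_tendsto hp0 h.tendsto_tail
  have hp2' : 0 < 2 - p := sub_pos.2 hp2
  have hk1' : 0 < 1 - k := sub_pos.2 hk1
  set K := 2 * C / (2 - p) with hK
  -- With `l = n^{-1/p + e}`, this `e` makes the exponent of `n` in the variance term exactly zero,
  -- while `l * b = n^{-(1-k)/2} ≤ 1`.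
  set e := (1 - k) * (2 - p) / (2 * p) with he
  refine ⟨1 + 4 / s, 2 * Real.exp K, s / 2, e, by positivity, by positivity, by positivity,
    by positivity, ?_⟩
  filter_upwards [eventually_gt_atTop 0,
    h.eventually_mean_low_le hX hp0 hk1 (div_pos hs four_pos)] with n hn0 hn
  have hn0' : (0 : ℝ) < n := by exact_mod_cast hn0
  have hn1 : (1 : ℝ) ≤ n := by exact_mod_cast hn0
  set q := n * P.real {ω | (n : ℝ) ^ (k / p) < |X ω|} with hq
  have hq0 : 0 ≤ q := by positivity
  have hR : 0 < 2 * Real.exp K * Real.exp (-(s / 2 * (n : ℝ) ^ e)) := by positivity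
  -- If `q ≥ s / 4`, the term `(4 / s) q` already exceeds 1. Otherwise the truncated mean uses up at
  -- most half of the deviation `s * a`.
  rcases le_total (s / 4) q with hsq | hsq
  · have : 1 ≤ 4 / s * q := by
      calc (1 : ℝ) = 4 / s * (s / 4) := by field_simp
        _ ≤ _ := by gcongr
    linarith [measureReal_le_one (μ := P)
      (s := {ω | s * (n : ℝ) ^ (1 / p) < |partialSum Xs n ω|})]
  set a := (n : ℝ) ^ (1 / p) with ha
  set b := (n : ℝ) ^ (k / p) with hb
  set l := (n : ℝ) ^ (-(1 / p) + e) with hl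
  have ha0 : 0 < a := by positivity
  have hb0 : 0 < b := by positivity
  have hl0 : 0 < l := by positivity
  have hlb : l * b ≤ 1 := by
    rw [hl, hb, ← Real.rpow_add hn0']
    refine Real.rpow_le_one_of_one_le_of_nonpos hn1 ?_
    have : -(1 / p) + e + k / p = -((1 - k) / 2) := by rw [he]; field_simp; ring
    rw [this]; linarith
  have hla : l * a = (n : ℝ) ^ e := by
    rw [hl, ha, ← Real.rpow_add hn0']; congr 1; ring
  have hmean : n * (l * |∫ ω, trunc b (X ω) ∂P|) ≤ s / 2 * (n : ℝ) ^ e := by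
    calc n * (l * |∫ ω, trunc b (X ω) ∂P|) = l * (n * |∫ ω, trunc b (X ω) ∂P|) := by ring
      _ ≤ l * (s / 4 * a + a * q) := by gcongr
      _ ≤ l * (s / 4 * a + a * (s / 4)) := by gcongr
      _ = s / 2 * (l * a) := by ring
      _ = _ := by rw [hla]
  have hvar : n * (l ^ 2 * ∫ ω, trunc b (X ω) ^ 2 ∂P) ≤ K := by
    calc n * (l ^ 2 * ∫ ω, trunc b (X ω) ^ 2 ∂P) ≤ n * (l ^ 2 * (K * b ^ (2 - p))) := by
          gcongr; exact integral_trunc_sq_le hX hC.le hp2 hb0 hC'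
      _ = K * ((n : ℝ) ^ (1 : ℝ) * l ^ (2 : ℝ) * b ^ (2 - p)) := by
          rw [Real.rpow_one, Real.rpow_two]; ring
      _ = K := by
          rw [hl, hb, ← Real.rpow_mul hn0'.le, ← Real.rpow_mul hn0'.le, ← Real.rpow_add hn0',
            ← Real.rpow_add hn0']
          have : 1 + (-(1 / p) + e) * 2 + k / p * (2 - p) = 0 := by rw [he]; field_simp; ring
          rw [this, Real.rpow_zero, mul_one]
  have hE := measureReal_lt_abs_sum_le hX hXs hindep hident (Finset.range n) (n := n) (by simp)
    (t := s * a) hb0.le hl0.le hlb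
  refine hE.trans (add_le_add ?_ ?_)
  · have : 0 ≤ 4 / s * q := by positivity
    linarith
  · rw [mul_assoc, ← Real.exp_add]
    have : l * (s * a) = s * (n : ℝ) ^ e := by rw [← hla]; ring
    refine mul_le_mul_of_nonneg_left (Real.exp_le_exp.2 ?_) two_pos.le
    rw [this, mul_add]
    linarith

/-- A single large summand, with the other ones under control, is a likely enough reason for a
large sum. -/
lemma half_mul_le_measureReal_lt_abs_partialSum {X : Ω → ℝ} {Xs : ℕ → Ω → ℝ}
    (hXs : ∀ n, Measurable (Xs n)) (hindep : iIndepFun Xs P)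
    (hident : ∀ n, IdentDistrib (Xs n) X P P) {n : ℕ} {u v : ℝ}
    (hu : n * P.real {ω | u + v < |X ω|} ≤ 1 / 4)
    (hv : ∀ i ∈ Finset.range n,
      P.real {ω | v < |∑ j ∈ (Finset.range n).erase i, Xs j ω|} ≤ 1 / 4) :
    n / 2 * P.real {ω | u + v < |X ω|} ≤ P.real {ω | u < |partialSum Xs n ω|} := by
  set q := P.real {ω | u + v < |X ω|} with hq
  have hq0 : 0 ≤ q := measureReal_nonneg
  let B : ℕ → Set Ω := fun i => {ω | u + v < |Xs i ω|}
  -- The cap on the other summands makes the events `B i ∩ H i` disjoint; the bound on their sum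
  -- lets the large summand prevail.
  let H : ℕ → Set Ω := fun i => {ω | (∀ j : ((Finset.range n).erase i : Finset ℕ),
    |Xs j ω| ≤ u + v) ∧ |∑ j : ((Finset.range n).erase i : Finset ℕ), Xs j ω| ≤ v}
  have hBm : ∀ i, MeasurableSet (B i) := fun i => measurableSet_lt measurable_const (hXs i).abs
  have hT : ∀ F : Finset ℕ,
      MeasurableSet {x : F → ℝ | (∀ j, |x j| ≤ u + v) ∧ |∑ j, x j| ≤ v} := fun F => by
    have h1 : MeasurableSet (⋂ j : F, {x : F → ℝ | |x j| ≤ u + v}) :=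
      MeasurableSet.iInter fun j => measurableSet_le (measurable_pi_apply j).abs measurable_const
    have h2 : MeasurableSet {x : F → ℝ | |∑ j, x j| ≤ v} :=
      measurableSet_le (Finset.measurable_sum _ fun j _ => measurable_pi_apply j).abs
        measurable_const
    convert h1.inter h2 using 1
    ext x
    simp only [Set.mem_ofPred_eq, Set.mem_inter_iff, Set.mem_iInter]
  have hHm : ∀ i, MeasurableSet (H i) := fun i =>
    measurable_pi_lambda _ (fun j : ((Finset.range n).erase i : Finset ℕ) => hXs j) (hT _)
  have hBq : ∀ i, P.real (B i) = q := fun i => identDistrib_measureReal_lt_abs (hident i) (u + v)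
  have hprod : ∀ i, P.real (B i ∩ H i) = q * P.real (H i) := by
    intro i
    have hind := hindep.indepFun_finset {i} ((Finset.range n).erase i) (by simp) hXs
    have := hind.measure_inter_preimage_eq_mul
      {x | u + v < |x ⟨i, Finset.mem_singleton_self i⟩|}
      {x | (∀ j, |x j| ≤ u + v) ∧ |∑ j, x j| ≤ v}
      (measurableSet_lt measurable_const (measurable_pi_apply _).abs)
      (hT _)
    rw [← hBq i, measureReal_def, measureReal_def, measureReal_def, ← ENNReal.toReal_mul]
    exact congrArg ENNReal.toReal this
  have hH : ∀ i ∈ Finset.range n, 1 / 2 ≤ P.real (H i) := by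
    intro i hi
    have hc : (H i)ᶜ ⊆ (⋃ j ∈ Finset.range n, B j) ∪
        {ω | v < |∑ j ∈ (Finset.range n).erase i, Xs j ω|} := by
      intro ω hω
      by_contra hcon
      simp only [Set.mem_union, Set.mem_iUnion, not_or, not_exists] at hcon
      refine hω ⟨fun j => ?_, ?_⟩
      · exact not_lt.1 (hcon.1 j (Finset.mem_of_mem_erase j.2))
      · rw [Finset.sum_coe_sort ((Finset.range n).erase i) fun j => Xs j ω]
        exact not_lt.1 hcon.2
    have h1 : P.real (⋃ j ∈ Finset.range n, B j) ≤ 1 / 4 := by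
      refine (measureReal_biUnion_finset_le _ _).trans ?_
      rw [Finset.sum_congr rfl fun j _ => hBq j]
      simpa using hu
    have h2 : P.real (H i)ᶜ ≤ 1 / 4 + 1 / 4 :=
      (measureReal_mono hc).trans ((measureReal_union_le _ _).trans (add_le_add h1 (hv i hi)))
    rw [probReal_compl_eq_one_sub (hHm i)] at h2
    linarith
  have hdisj : ((Finset.range n : Finset ℕ) : Set ℕ).PairwiseDisjoint fun i => B i ∩ H i := by
    intro i hi j hj hij
    refine Set.disjoint_left.2 fun ω hωi hωj => ?_
    have h1 := hωi.2.1 ⟨j, Finset.mem_erase.2 ⟨hij.symm, hj⟩⟩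
    exact absurd hωj.1 (not_lt.2 h1)
  have hsub : (⋃ i ∈ Finset.range n, B i ∩ H i) ⊆ {ω | u < |partialSum Xs n ω|} := by
    intro ω hω
    simp only [Set.mem_iUnion] at hω
    obtain ⟨i, hi, hB, -, hS⟩ := hω
    rw [Finset.sum_coe_sort ((Finset.range n).erase i) fun j => Xs j ω] at hS
    have hB' : u + v < |Xs i ω| := hB
    have hsum : partialSum Xs n ω = Xs i ω + ∑ j ∈ (Finset.range n).erase i, Xs j ω :=
      (Finset.add_sum_erase _ _ hi).symm
    have := abs_sub_abs_le_abs_sub (Xs i ω) (-∑ j ∈ (Finset.range n).erase i, Xs j ω)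
    rw [sub_neg_eq_add, ← hsum, abs_neg] at this
    simp only [Set.mem_ofPred_eq]
    linarith
  calc n / 2 * q = ∑ i ∈ Finset.range n, q * (1 / 2) := by
        rw [Finset.sum_const, Finset.card_range, nsmul_eq_mul]; ring
    _ ≤ ∑ i ∈ Finset.range n, P.real (B i ∩ H i) := Finset.sum_le_sum fun i hi => by
        rw [hprod]; exact mul_le_mul_of_nonneg_left (hH i hi) hq0
    _ = P.real (⋃ i ∈ Finset.range n, B i ∩ H i) :=
        (measureReal_biUnion_finset hdisj fun i _ => (hBm i).inter (hHm i)).symm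
    _ ≤ _ := measureReal_mono hsub

/-- The other summands are handled by the Chernoff bound at truncation level `a = n^{1/p}` with `l =
1 / a`, where the mean and variance terms are bounded by constants `K` and `V`; a large enough
multiple of `a` outweighs them. -/
lemma WeakLawCondition.exists_lower_bound {X : Ω → ℝ} {Xs : ℕ → Ω → ℝ} {p : ℝ}
    (h : WeakLawCondition P X p) (hp0 : 0 < p) (hp2 : p < 2) (hX : Measurable X)
    (hXs : ∀ n, Measurable (Xs n)) (hindep : iIndepFun Xs P)
    (hident : ∀ n, IdentDistrib (Xs n) X P P) {s : ℝ} (hs : 0 < s) :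
    ∃ A : ℝ, 0 < A ∧ ∀ᶠ n : ℕ in atTop,
      n / 2 * P.real {ω | A * (n : ℝ) ^ (1 / p) < |X ω|} ≤
        P.real {ω | s * (n : ℝ) ^ (1 / p) < |partialSum Xs n ω|} := by
  obtain ⟨C, hC, hC'⟩ := exists_tail_bound_of_tendsto hp0 h.tendsto_tail
  obtain ⟨K, hK0, hK⟩ := h.exists_mean_bound hX hp0
  have hp2' : 0 < 2 - p := sub_pos.2 hp2
  set V := 2 * C / (2 - p) with hV
  have hV0 : 0 < V := by positivity
  -- The exponent becomes at most `-4`, and `2 e^{-4} ≤ 1/8`; together with the union bound term, at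
  -- most `1/8`, this gives the required `1/4`.
  set M := K + V + 4 with hM
  refine ⟨s + M, by positivity, ?_⟩
  filter_upwards [eventually_gt_atTop 0, hK,
    h.tendsto_tail.eventually_le_const (show (0 : ℝ) < 1 / 8 by norm_num)] with n hn0 hn hn8
  have hn0' : (0 : ℝ) < n := by exact_mod_cast hn0
  set a := (n : ℝ) ^ (1 / p) with ha
  have ha0 : 0 < a := by positivity
  have hna : (n : ℝ) = a ^ p := by
    rw [ha, ← Real.rpow_mul hn0'.le, one_div_mul_cancel hp0.ne', Real.rpow_one]
  rw [add_mul]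
  refine half_mul_le_measureReal_lt_abs_partialSum hXs hindep hident ?_ fun i hi => ?_
  · have : P.real {ω | s * a + M * a < |X ω|} ≤ P.real {ω | a < |X ω|} := by
      have h1 : a ≤ s * a + M * a := by nlinarith
      exact measureReal_mono fun ω hω => lt_of_le_of_lt h1 hω
    have := mul_le_mul_of_nonneg_left this hn0'.le
    linarith
  · have hE := measureReal_lt_abs_sum_le hX hXs hindep hident ((Finset.range n).erase i) (n := n)
      (by rw [Finset.card_erase_of_mem hi, Finset.card_range]; omega)
      (t := M * a) (l := a⁻¹) ha0.le (inv_nonneg.2 ha0.le) (inv_mul_cancel₀ ha0.ne').le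
    refine hE.trans ?_
    have h1 : n * (a⁻¹ * |∫ ω, trunc a (X ω) ∂P|) ≤ K := by
      calc _ = (n * |∫ ω, trunc a (X ω) ∂P|) / a := by rw [div_eq_mul_inv]; ring
        _ ≤ K := (div_le_iff₀ ha0).2 hn
    have h2 : n * (a⁻¹ ^ 2 * ∫ ω, trunc a (X ω) ^ 2 ∂P) ≤ V := by
      calc _ ≤ n * (a⁻¹ ^ 2 * (V * a ^ (2 - p))) := by
            gcongr; exact integral_trunc_sq_le hX hC.le hp2 ha0 hC'
        _ = V * (a ^ p * a ^ (2 - p) / a ^ 2) := by rw [hna]; field_simp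
        _ = V := by
            rw [← Real.rpow_add ha0, add_sub_cancel, Real.rpow_two, div_self (by positivity),
              mul_one]
    have h3 : a⁻¹ * (M * a) = M := by field_simp
    have h4 : Real.exp (-(a⁻¹ * (M * a)) + n * (a⁻¹ * |∫ ω, trunc a (X ω) ∂P|
        + a⁻¹ ^ 2 * ∫ ω, trunc a (X ω) ^ 2 ∂P)) ≤ Real.exp (-4) := by
      rw [Real.exp_le_exp, h3, mul_add]; linarith
    have h5 : Real.exp (-4) ≤ 1 / 16 := by
      rw [Real.exp_neg, ← one_div]
      refine one_div_le_one_div_of_le (by norm_num) ?_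
      have h6 : (2 : ℝ) ≤ Real.exp 1 := by linarith [Real.add_one_le_exp (1 : ℝ)]
      calc (16 : ℝ) = 2 ^ 4 := by norm_num
        _ ≤ Real.exp 1 ^ 4 := by gcongr
        _ = Real.exp 4 := by rw [← Real.exp_nat_mul]; norm_num
    linarith

end

/-! ### From logarithmic rates to power bounds -/

lemma one_div_mul_log_le_iff {l : ℝ} (hl : 0 < l) (c : ℝ) (m : ENNReal) :
    ((1 / l : ℝ) : EReal) * ENNReal.log m ≤ c ↔ m ≤ ENNReal.ofReal (Real.exp (c * l)) := by
  rw [← EReal.exp_coe, ← ENNReal.log_le_log_iff, EReal.log_exp, mul_comm c l, EReal.coe_mul,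
    ← EReal.div_le_iff_le_mul (by exact_mod_cast hl) (EReal.coe_ne_top _),
    EReal.div_eq_inv_mul, one_div, EReal.coe_inv]

lemma le_one_div_mul_log_iff {l : ℝ} (hl : 0 < l) (c : ℝ) (m : ENNReal) :
    (c : EReal) ≤ ((1 / l : ℝ) : EReal) * ENNReal.log m ↔
      ENNReal.ofReal (Real.exp (c * l)) ≤ m := by
  rw [← EReal.exp_coe, ← ENNReal.log_le_log_iff, EReal.log_exp, EReal.coe_mul,
    ← EReal.le_div_iff_mul_le (by exact_mod_cast hl) (EReal.coe_ne_top _),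
    EReal.div_eq_inv_mul, one_div, EReal.coe_inv]

lemma tendsto_mul_log_natCast_add {α : ℝ} (hα : 0 < α) (d : ℝ) :
    Tendsto (fun n : ℕ => α * Real.log n + d) atTop atTop :=
  tendsto_atTop_add_const_right _ _
    ((Real.tendsto_log_atTop.comp tendsto_natCast_atTop_atTop).const_mul_atTop hα)

lemma exp_mul_log_natCast_add {n : ℕ} (hn : 0 < n) (α d : ℝ) :
    Real.exp (α * Real.log n + d) = Real.exp d * (n : ℝ) ^ α := by
  rw [Real.exp_add, mul_comm, Real.rpow_def_of_pos (by exact_mod_cast hn), mul_comm α]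

lemma measureReal_lt_log_abs {Ω : Type*} [MeasurableSpace Ω] {P : Measure Ω}
    (X : Ω → ℝ) {t : ℝ} (ht : 0 ≤ t) :
    P.real {ω | t < Real.log |X ω|} = P.real {ω | Real.exp t < |X ω|} := by
  congr 1
  ext ω
  rcases (abs_nonneg (X ω)).eq_or_lt with h | h
  · simp only [Set.mem_ofPred_eq, ← h, Real.log_zero]
    exact iff_of_false (not_lt.2 ht) (not_lt.2 (Real.exp_nonneg t))
  · exact Real.lt_log_iff_exp_lt h

section

variable {Ω : Type*} [MeasurableSpace Ω] {P : Measure Ω} [IsProbabilityMeasure P]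

lemma logTailRate_le_iff (X : Ω → ℝ) {t : ℝ} (ht : 0 < t) (c : ℝ) :
    logTailRate P X t ≤ c ↔ P.real {ω | Real.exp t < |X ω|} ≤ Real.exp (c * t) := by
  rw [logTailRate, one_div_mul_log_le_iff ht, ← measureReal_lt_log_abs X ht.le,
    ENNReal.le_ofReal_iff_toReal_le (measure_ne_top _ _) (Real.exp_nonneg _), measureReal_def]

lemma le_logTailRate_iff (X : Ω → ℝ) {t : ℝ} (ht : 0 < t) (c : ℝ) :
    c ≤ logTailRate P X t ↔ Real.exp (c * t) ≤ P.real {ω | Real.exp t < |X ω|} := by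
  rw [logTailRate, le_one_div_mul_log_iff ht, ← measureReal_lt_log_abs X ht.le,
    ENNReal.ofReal_le_iff_le_toReal (measure_ne_top _ _), measureReal_def]

lemma logDeviationRate_le_iff (Xs : ℕ → Ω → ℝ) (p s : ℝ) {n : ℕ} (hn : 1 < n) (c : ℝ) :
    logDeviationRate P Xs p s n ≤ c ↔
      P.real {ω | s * (n : ℝ) ^ (1 / p) < |partialSum Xs n ω|} ≤ (n : ℝ) ^ c := by
  have hn' : (1 : ℝ) < n := by exact_mod_cast hn
  rw [logDeviationRate, one_div_mul_log_le_iff (Real.log_pos hn'),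
    ENNReal.le_ofReal_iff_toReal_le (measure_ne_top _ _) (Real.exp_nonneg _), measureReal_def,
    Real.rpow_def_of_pos (y := c) (by linarith), mul_comm c]

lemma le_logDeviationRate_iff (Xs : ℕ → Ω → ℝ) (p s : ℝ) {n : ℕ} (hn : 1 < n) (c : ℝ) :
    c ≤ logDeviationRate P Xs p s n ↔
      (n : ℝ) ^ c ≤ P.real {ω | s * (n : ℝ) ^ (1 / p) < |partialSum Xs n ω|} := by
  have hn' : (1 : ℝ) < n := by exact_mod_cast hn
  rw [logDeviationRate, le_one_div_mul_log_iff (Real.log_pos hn'),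
    ENNReal.ofReal_le_iff_le_toReal (measure_ne_top _ _), measureReal_def,
    Real.rpow_def_of_pos (y := c) (by linarith), mul_comm c]

lemma eventually_mul_exp_neg_rpow_le {δ e : ℝ} (hδ : 0 < δ) (he : 0 < e) (D y : ℝ) {ε : ℝ}
    (hε : 0 < ε) : ∀ᶠ n : ℕ in atTop, D * Real.exp (-(δ * (n : ℝ) ^ e)) ≤ ε * (n : ℝ) ^ y := by
  have h1 : Tendsto (fun x : ℝ => x ^ (-y / e) * Real.exp (-δ * x)) atTop (𝓝 0) :=
    tendsto_rpow_mul_exp_neg_mul_atTop_nhds_zero _ _ hδ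
  have h2 : Tendsto (fun n : ℕ => (n : ℝ) ^ e) atTop atTop :=
    (tendsto_rpow_atTop he).comp tendsto_natCast_atTop_atTop
  have h3 := (h1.comp h2).const_mul D
  rw [mul_zero] at h3
  filter_upwards [h3.eventually_le_const hε, eventually_gt_atTop 0] with n hn hn0
  have hn0' : (0 : ℝ) < n := by exact_mod_cast hn0
  simp only [Function.comp] at hn
  rw [← Real.rpow_mul hn0'.le, mul_div_cancel₀ _ he.ne', Real.rpow_neg hn0'.le, neg_mul] at hn
  have hy := Real.rpow_pos_of_pos hn0' y
  calc D * Real.exp (-(δ * (n : ℝ) ^ e))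
      = D * (((n : ℝ) ^ y)⁻¹ * Real.exp (-(δ * (n : ℝ) ^ e))) * (n : ℝ) ^ y := by
        field_simp
    _ ≤ ε * (n : ℝ) ^ y := mul_le_mul_of_nonneg_right hn hy.le

/-- Stated as an implication for each large `n`, so that it serves both the limsup (premise
eventually true) and the liminf (premise frequently true). -/
lemma WeakLawCondition.logDeviationRate_le {X : Ω → ℝ} {Xs : ℕ → Ω → ℝ} {p : ℝ}
    (h : WeakLawCondition P X p) (hp0 : 0 < p) (hp2 : p < 2) (hX : Measurable X)
    (hXs : ∀ n, Measurable (Xs n)) (hindep : iIndepFun Xs P)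
    (hident : ∀ n, IdentDistrib (Xs n) X P P) {s c c' : ℝ} (hs : 0 < s) (hc : c < c') :
    ∃ α : ℝ, 0 < α ∧ ∀ᶠ n : ℕ in atTop, logTailRate P X (α * Real.log n + 0) ≤ c →
      logDeviationRate P Xs p s n ≤ (1 + c' / p : ℝ) := by
  -- The sign of `c` is arbitrary, so `k` is found by continuity at 1 from the left.
  obtain ⟨k, hkc, hk0, hk1⟩ : ∃ k : ℝ, k * c < c' ∧ 0 < k ∧ k < 1 := by
    have h1 : Tendsto (fun k : ℝ => k * c) (𝓝[<] 1) (𝓝 (1 * c)) :=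
      ((continuous_id.mul continuous_const).tendsto 1).mono_left nhdsWithin_le_nhds
    rw [one_mul] at h1
    obtain ⟨k, hk, hk'⟩ := ((h1.eventually_lt_const hc).and
      (Ioo_mem_nhdsLT (show (0 : ℝ) < 1 by norm_num))).exists
    exact ⟨k, hk, hk'⟩
  obtain ⟨C, D, δ, e, hC, hD, hδ, he, hU⟩ :=
    h.exists_upper_bound hp0 hp2 hX hXs hindep hident hs hk1
  have hα : 0 < k / p := div_pos hk0 hp0
  have hexp : 1 + c * (k / p) < 1 + c' / p := by
    have : c * (k / p) < c' / p := by
      rw [← mul_div_assoc]; exact div_lt_div_of_pos_right (by linarith) hp0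
    linarith
  refine ⟨k / p, hα, ?_⟩
  filter_upwards [hU, eventually_gt_atTop 1,
    (tendsto_mul_log_natCast_add hα 0).eventually_gt_atTop 0,
    eventually_mul_natCast_rpow_le hexp one_half_pos C,
    eventually_mul_exp_neg_rpow_le hδ he D (1 + c' / p) one_half_pos] with n hn hn1 hσ h1 h2 hr
  have hn0 : (0 : ℝ) < n := by exact_mod_cast (zero_lt_one.trans hn1)
  rw [logDeviationRate_le_iff Xs p s hn1]
  rw [logTailRate_le_iff X hσ, exp_mul_log_natCast_add (by omega), Real.exp_zero, one_mul] at hr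
  have h3 : Real.exp (c * (k / p * Real.log n + 0)) = (n : ℝ) ^ (c * (k / p)) := by
    rw [Real.rpow_def_of_pos hn0]; congr 1; ring
  rw [h3] at hr
  have h4 : C * (n * P.real {ω | (n : ℝ) ^ (k / p) < |X ω|}) ≤
      C * (n : ℝ) ^ (1 + c * (k / p)) := by
    rw [Real.rpow_add hn0, Real.rpow_one]; gcongr
  linarith

lemma WeakLawCondition.le_logDeviationRate {X : Ω → ℝ} {Xs : ℕ → Ω → ℝ} {p : ℝ}
    (h : WeakLawCondition P X p) (hp0 : 0 < p) (hp2 : p < 2) (hX : Measurable X)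
    (hXs : ∀ n, Measurable (Xs n)) (hindep : iIndepFun Xs P)
    (hident : ∀ n, IdentDistrib (Xs n) X P P) {s c c' : ℝ} (hs : 0 < s) (hc : c' < c) :
    ∃ d : ℝ, ∀ᶠ n : ℕ in atTop, c ≤ logTailRate P X (1 / p * Real.log n + d) →
      (1 + c' / p : ℝ) ≤ logDeviationRate P Xs p s n := by
  obtain ⟨A, hA, hL⟩ := h.exists_lower_bound hp0 hp2 hX hXs hindep hident hs
  have hexp : 1 + c' / p < 1 + c / p := by
    have := div_lt_div_of_pos_right hc hp0
    linarith
  -- The constant factor `A` in the threshold becomes an additive shift on the logarithmic scale.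
  refine ⟨Real.log A, ?_⟩
  filter_upwards [hL, eventually_gt_atTop 1,
    (tendsto_mul_log_natCast_add (one_div_pos.2 hp0) (Real.log A)).eventually_gt_atTop 0,
    eventually_mul_natCast_rpow_le hexp
      (show 0 < Real.exp (c * Real.log A) / 2 by positivity) 1] with n hn hn1 hσ h1 hr
  have hn0 : (0 : ℝ) < n := by exact_mod_cast (zero_lt_one.trans hn1)
  rw [le_logDeviationRate_iff Xs p s hn1]
  rw [le_logTailRate_iff X hσ, exp_mul_log_natCast_add (by omega), Real.exp_log hA] at hr
  have h3 : Real.exp (c * (1 / p * Real.log n + Real.log A)) =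
      Real.exp (c * Real.log A) * (n : ℝ) ^ (c / p) := by
    rw [Real.rpow_def_of_pos hn0, ← Real.exp_add]; congr 1; ring
  rw [h3] at hr
  refine le_trans ?_ hn
  calc (n : ℝ) ^ (1 + c' / p) ≤ Real.exp (c * Real.log A) / 2 * (n : ℝ) ^ (1 + c / p) := by
        linarith
    _ = n / 2 * (Real.exp (c * Real.log A) * (n : ℝ) ^ (c / p)) := by
        rw [Real.rpow_add hn0, Real.rpow_one]; ring
    _ ≤ _ := by gcongr

/-! ### From continuous `t` to logarithmic sequences -/

lemma measureReal_exp_lt_abs_anti (X : Ω → ℝ) {t u : ℝ} (htu : t ≤ u) :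
    P.real {ω | Real.exp u < |X ω|} ≤ P.real {ω | Real.exp t < |X ω|} :=
  measureReal_mono fun _ hω => lt_of_le_of_lt (Real.exp_le_exp.2 htu) hω

/-- Small values of the tail rate persist along logarithmic sequences. -/
lemma frequently_logTailRate_natCast_le (X : Ω → ℝ) {α d c c' : ℝ} (hα : 0 < α) (hc : c < c')
    (h : ∃ᶠ t in atTop, logTailRate P X t ≤ c) :
    ∃ᶠ n : ℕ in atTop, logTailRate P X (α * Real.log n + d) ≤ c' := by
  refine frequently_atTop.2 fun N => ?_
  -- Rounding moves `t` by at most `α log 2`; for `t` this large the resulting change in the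
  -- exponent is absorbed by `(c' - c) t`.
  obtain ⟨t, hr, ht0, htN, htc⟩ := (h.and_eventually ((eventually_gt_atTop 0).and
    ((eventually_ge_atTop (d + α * N)).and
      (eventually_ge_atTop (|c'| * (α * Real.log 2) / (c' - c)))))).exists
  rw [div_le_iff₀ (sub_pos.2 hc)] at htc
  have hx : (N : ℝ) ≤ (t - d) / α := by rw [le_div_iff₀ hα]; linarith
  set x := (t - d) / α with hxdef
  have htx : t = α * x + d := by rw [hxdef]; field_simp; ring
  have hexp1 : 1 ≤ Real.exp x := Real.one_le_exp ((Nat.cast_nonneg N).trans hx)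
  -- Rounding up moves the level above `t`, where the tail is smaller.
  set n := ⌈Real.exp x⌉₊ with hn
  have hnge : Real.exp x ≤ n := Nat.le_ceil _
  have hnle : (n : ℝ) ≤ 2 * Real.exp x := by
    have := (Nat.ceil_lt_add_one (Real.exp_nonneg x)).le
    linarith
  have hn0 : (0 : ℝ) < n := (Real.exp_pos x).trans_le hnge
  have hlog1 : x ≤ Real.log n := (Real.le_log_iff_exp_le hn0).2 hnge
  have hlog2 : Real.log n ≤ Real.log 2 + x := by
    have := Real.log_le_log hn0 hnle
    rwa [Real.log_mul two_ne_zero (Real.exp_ne_zero x), Real.log_exp] at this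
  have hσ1 : t ≤ α * Real.log n + d := by rw [htx]; gcongr
  have hσ2 : α * Real.log n + d ≤ t + α * Real.log 2 := by
    rw [htx]; nlinarith
  refine ⟨n, ?_, ?_⟩
  · have : (N : ℝ) ≤ n := (hx.trans (by linarith [Real.add_one_le_exp x])).trans hnge
    exact_mod_cast this
  · rw [logTailRate_le_iff X (ht0.trans_le hσ1)]
    rw [logTailRate_le_iff X ht0] at hr
    refine (measureReal_exp_lt_abs_anti X hσ1).trans (hr.trans (Real.exp_le_exp.2 ?_))
    have h1 : -(|c'| * (α * Real.log 2)) ≤ c' * (α * Real.log n + d - t) := by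
      have h2 : |c' * (α * Real.log n + d - t)| ≤ |c'| * (α * Real.log 2) := by
        rw [abs_mul, abs_of_nonneg (sub_nonneg.2 hσ1)]
        gcongr; linarith
      exact (abs_le.1 h2).1
    linarith

/-- Large values of the tail rate persist along logarithmic sequences. -/
lemma frequently_le_logTailRate_natCast (X : Ω → ℝ) {α d c c' : ℝ} (hα : 0 < α) (hc : c' < c)
    (h : ∃ᶠ t in atTop, c ≤ logTailRate P X t) :
    ∃ᶠ n : ℕ in atTop, c' ≤ logTailRate P X (α * Real.log n + d) := by
  refine frequently_atTop.2 fun N => ?_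
  obtain ⟨t, hr, ht0, htN, htc⟩ := (h.and_eventually ((eventually_gt_atTop (α * Real.log 2)).and
    ((eventually_ge_atTop (d + α * N)).and
      (eventually_ge_atTop (|c'| * (α * Real.log 2) / (c - c')))))).exists
  rw [div_le_iff₀ (sub_pos.2 hc)] at htc
  have hx : (N : ℝ) ≤ (t - d) / α := by rw [le_div_iff₀ hα]; linarith
  set x := (t - d) / α with hxdef
  have htx : t = α * x + d := by rw [hxdef]; field_simp; ring
  have hlog20 : 0 < Real.log 2 := Real.log_pos one_lt_two
  have hexp1 : 1 ≤ Real.exp x := Real.one_le_exp ((Nat.cast_nonneg N).trans hx)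
  -- Rounding down moves the level below `t`, where the tail is larger.
  set n := ⌊Real.exp x⌋₊ with hn
  have hnle : (n : ℝ) ≤ Real.exp x := Nat.floor_le (Real.exp_nonneg x)
  have hn1 : (1 : ℝ) ≤ n := by exact_mod_cast Nat.le_floor (by exact_mod_cast hexp1)
  have hnge : Real.exp x ≤ 2 * n := by
    have := (Nat.lt_floor_add_one (Real.exp x)).le
    linarith
  have hn0 : (0 : ℝ) < n := by linarith
  have hlog1 : Real.log n ≤ x := (Real.log_le_iff_le_exp hn0).2 hnle
  have hlog2 : x ≤ Real.log 2 + Real.log n := by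
    rw [← Real.log_mul two_ne_zero hn0.ne']
    exact (Real.le_log_iff_exp_le (by positivity)).2 hnge
  have hσ1 : α * Real.log n + d ≤ t := by rw [htx]; gcongr
  have hσ2 : t ≤ α * Real.log n + d + α * Real.log 2 := by
    rw [htx]; nlinarith
  refine ⟨n, Nat.le_floor (hx.trans (by linarith [Real.add_one_le_exp x])), ?_⟩
  have ht0' : 0 < t := lt_trans (by positivity) ht0
  rw [le_logTailRate_iff X (by linarith)]
  rw [le_logTailRate_iff X ht0'] at hr
  refine (Real.exp_le_exp.2 ?_).trans (hr.trans (measureReal_exp_lt_abs_anti X hσ1))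
  have h1 : -(|c'| * (α * Real.log 2)) ≤ c' * (t - (α * Real.log n + d)) := by
    have h2 : |c' * (t - (α * Real.log n + d))| ≤ |c'| * (α * Real.log 2) := by
      rw [abs_mul, abs_of_nonneg (sub_nonneg.2 hσ1)]
      gcongr; linarith
    exact (abs_le.1 h2).1
  linarith

end

/-! ### Extended real arithmetic and the conclusion -/

/-- Here `x` plays the limsup or liminf of the tail rate, that is `-β`. Testing against real `d`
treats infinite values together with finite ones. -/
lemma EReal.neg_neg_sub_div_lt_coe_iff {p : ℝ} (hp : 0 < p) (x : EReal) (d : ℝ) :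
    -(-x - (p : EReal)) / (p : EReal) < d ↔ x < (p * (d - 1) : ℝ) := by
  rw [EReal.div_lt_iff (by exact_mod_cast hp) (EReal.coe_ne_top p)]
  induction x with
  | bot => simp [← EReal.coe_mul]
  | top => simp [← EReal.coe_mul]
  | coe x =>
    norm_cast
    constructor <;> intro h <;> linarith

lemma EReal.coe_lt_neg_neg_sub_div_iff {p : ℝ} (hp : 0 < p) (x : EReal) (d : ℝ) :
    d < -(-x - (p : EReal)) / (p : EReal) ↔ (p * (d - 1) : ℝ) < x := by
  rw [EReal.lt_div_iff (by exact_mod_cast hp) (EReal.coe_ne_top p)]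
  induction x with
  | bot => simp [← EReal.coe_mul]
  | top => simp [← EReal.coe_mul]
  | coe x =>
    norm_cast
    constructor <;> intro h <;> linarith

lemma EReal.neg_sub_div_injective {p : ℝ} (hp : 0 < p) :
    Function.Injective fun x : EReal => -(x - (p : EReal)) / (p : EReal) := by
  have key : ∀ x y : EReal,
      -(x - (p : EReal)) / (p : EReal) = -(y - (p : EReal)) / (p : EReal) → -x ≤ -y := by
    intro x y h
    refine le_of_forall_gt_imp_ge_of_dense fun c hc => ?_
    obtain ⟨r, hr, hrc⟩ := EReal.lt_iff_exists_real_btwn.1 hc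
    have h1 : p * ((1 + r / p) - 1) = r := by field_simp; ring
    have h2 := (EReal.neg_neg_sub_div_lt_coe_iff hp (-y) (1 + r / p)).2 (by rwa [h1])
    rw [neg_neg, ← h, ← neg_neg x, EReal.neg_neg_sub_div_lt_coe_iff hp, h1] at h2
    exact h2.le.trans hrc.le
  intro x y h
  exact neg_injective (le_antisymm (key x y h) (key y x h.symm))

theorem theorem2p2 {Ω : Type*} [MeasurableSpace Ω] (P : Measure Ω) [IsProbabilityMeasure P]
    (p : ℝ) (hp0 : 0 < p) (hp2 : p < 2)
    (X : Ω → ℝ) (Xs : ℕ → Ω → ℝ)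
    (hX : Measurable X) (hXs : ∀ n, Measurable (Xs n))
    (hindep : iIndepFun Xs P) (hident : ∀ n, IdentDistrib (Xs n) X P P)
    (hwlln : WeakLawCondition P X p) :
    ∀ s : ℝ, 0 < s →
      limsup (fun n : ℕ => logDeviationRate P Xs p s n) atTop
          = -(betaUpper P X - (p : EReal)) / (p : EReal) ∧
      liminf (fun n : ℕ => logDeviationRate P Xs p s n) atTop
          = -(betaLower P X - (p : EReal)) / (p : EReal) ∧
      ∀ β : EReal,
        Tendsto (fun n : ℕ => logDeviationRate P Xs p s n) atTop
            (𝓝 (-(β - (p : EReal)) / (p : EReal))) ↔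
          betaUpper P X = β ∧ betaLower P X = β := by
  intro s hs
  have hval : ∀ d : ℝ, 1 + p * (d - 1) / p = d := fun d => by field_simp; ring
  have hup : ∀ {c d : ℝ}, c < p * (d - 1) → ∃ α : ℝ, 0 < α ∧ ∀ᶠ n : ℕ in atTop,
      logTailRate P X (α * Real.log n + 0) ≤ c → logDeviationRate P Xs p s n ≤ d := by
    intro c d hcd
    have := hwlln.logDeviationRate_le hp0 hp2 hX hXs hindep hident hs hcd
    rwa [hval] at this
  have hlow : ∀ {c d : ℝ}, p * (d - 1) < c → ∃ b : ℝ, ∀ᶠ n : ℕ in atTop,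
      c ≤ logTailRate P X (1 / p * Real.log n + b) → d ≤ logDeviationRate P Xs p s n := by
    intro c d hcd
    have := hwlln.le_logDeviationRate hp0 hp2 hX hXs hindep hident hs hcd
    rwa [hval] at this
  have hp' : 0 < 1 / p := one_div_pos.2 hp0
  have hsup : limsup (fun n : ℕ => logDeviationRate P Xs p s n) atTop
      = -(betaUpper P X - (p : EReal)) / (p : EReal) := by
    refine le_antisymm (EReal.le_of_forall_lt_iff_le.1 fun d hd => ?_)
      (EReal.ge_of_forall_gt_iff_ge.1 fun d hd => ?_)
    · rw [betaUpper, EReal.neg_neg_sub_div_lt_coe_iff hp0] at hd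
      obtain ⟨c, hc, hcd⟩ := EReal.lt_iff_exists_real_btwn.1 hd
      obtain ⟨α, hα, hev⟩ := hup (EReal.coe_lt_coe_iff.1 hcd)
      have h1 := (tendsto_mul_log_natCast_add hα 0).eventually (eventually_lt_of_limsup_lt hc)
      refine limsup_le_of_le (h := ?_)
      filter_upwards [hev, h1] with n hn hn' using hn hn'.le
    · rw [betaUpper, EReal.coe_lt_neg_neg_sub_div_iff hp0] at hd
      obtain ⟨c, hdc, hc⟩ := EReal.lt_iff_exists_real_btwn.1 hd
      -- A frequent bound along real `t` reaches the sequence only with a loss, hence the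
      -- intermediate `c'`; eventual bounds restrict to the sequence at no cost.
      obtain ⟨c', hdc', hc'⟩ := exists_between (EReal.coe_lt_coe_iff.1 hdc)
      obtain ⟨b, hev⟩ := hlow hdc'
      have h1 := frequently_le_logTailRate_natCast X (d := b) hp' hc'
        ((frequently_lt_of_lt_limsup (h := hc)).mono fun _ h => h.le)
      exact le_limsup_of_frequently_le' ((h1.and_eventually hev).mono fun n hn => hn.2 hn.1)
  have hinf : liminf (fun n : ℕ => logDeviationRate P Xs p s n) atTop
      = -(betaLower P X - (p : EReal)) / (p : EReal) := by
    refine le_antisymm (EReal.le_of_forall_lt_iff_le.1 fun d hd => ?_)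
      (EReal.ge_of_forall_gt_iff_ge.1 fun d hd => ?_)
    · rw [betaLower, EReal.neg_neg_sub_div_lt_coe_iff hp0] at hd
      obtain ⟨c, hc, hcd⟩ := EReal.lt_iff_exists_real_btwn.1 hd
      obtain ⟨c', hc', hcd'⟩ := exists_between (EReal.coe_lt_coe_iff.1 hcd)
      obtain ⟨α, hα, hev⟩ := hup hcd'
      have h1 := frequently_logTailRate_natCast_le X (d := 0) hα hc'
        ((frequently_lt_of_liminf_lt (h := hc)).mono fun _ h => h.le)
      exact liminf_le_of_frequently_le' ((h1.and_eventually hev).mono fun n hn => hn.2 hn.1)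
    · rw [betaLower, EReal.coe_lt_neg_neg_sub_div_iff hp0] at hd
      obtain ⟨c, hdc, hc⟩ := EReal.lt_iff_exists_real_btwn.1 hd
      obtain ⟨b, hev⟩ := hlow (EReal.coe_lt_coe_iff.1 hdc)
      have h1 := (tendsto_mul_log_natCast_add hp' b).eventually (eventually_lt_of_lt_liminf hc)
      refine le_liminf_of_le (h := ?_)
      filter_upwards [hev, h1] with n hn hn' using hn hn'.le
  refine ⟨hsup, hinf, fun β => ⟨fun h => ?_, ?_⟩⟩
  · exact ⟨EReal.neg_sub_div_injective hp0 (hsup.symm.trans h.limsup_eq),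
      EReal.neg_sub_div_injective hp0 (hinf.symm.trans h.liminf_eq)⟩
  · rintro ⟨h1, h2⟩
    rw [h1] at hsup
    rw [h2] at hinf
    exact tendsto_of_le_liminf_of_limsup_le hinf.ge hsup.le
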